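/- **Proposition 1.4.** Let $m,n\ge 1$ be integers. The generalized Mazur pattern $Q_{m,n}$ is the (unoriented) knot in the solid torus $V=S^1\times D^2$ with the following diagram in the annulus: starting at a point, wind $m$ times around the solid torus in a spiral, then turn around and wind $n$ times backwards, continuing the spiral without crossings; then join the top endpoint of this arc to its bottom endpoint by an arc which crosses first under the $n$ backward strands and then over the $m$ forward strands, in such a way that it passes between the two legs of the turn and forms a clasp with it. Explicitly, put $N=m+n+1$ and, for $\theta,l,z\in\mathbb R$, let $P(\theta,l,z)=\big(\theta,\ \tfrac{2l-N}{2N}+iz\big)\in\mathbb R\times D^2$, where $D^2\subset\mathbb C$ is the closed unit disc. Then $Q_{m,n}$ is the image under the covering map $\mathbb R\times D^2\to S^1\times D^2$, $(\theta,v)\mapsto(e^{2\pi i\theta},v)$, of the polygonal path with the successive vertices $$P(0,0,0),\ P(m,m,0),\ P(m+\tfrac14,m+\tfrac12,0),\ P(m,m+1,0),\ P(m-n,N,0),$$ $$P(m-n,N,-\tfrac14),\ P(m-n,m+\tfrac12,-\tfrac14),\ P(m-n,m+\tfrac12,\tfrac14),\ P(m-n,0,\tfrac14),\ P(m-n,0,0).$$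 Then $Q_{m,n}$ is isotopic to $Q_{n,m}$ inside $V$: there is a continuous family $(H_t)_{t\in[0,1]}$ of homeomorphisms $V\to V$, each fixing $\partial V=S^1\times\partial D^2$ pointwise, such that $H_0=\mathrm{id}_V$ and $H_1(Q_{m,n})=Q_{n,m}$. -/

import Mathlib

/-- The solid torus `S¹ × D²`, with `S¹` the unit circle and `D²` the closed unit disc of `ℂ`. -/
abbrev SolidTorus : Type := Circle × Metric.closedBall (0 : ℂ) 1

/-- Two subsets `K`, `L` of the solid torus are isotopic (as unoriented knots) if there is an
ambient isotopy, i.e. a continuous family `H t`, `t ∈ [0, 1]`, of self-homeomorphisms of the solid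
torus, fixing the boundary `S¹ × ∂D²` pointwise, with `H 0` the identity and `H 1` carrying `K`
onto `L`. -/
def SolidTorus.Isotopic (K L : Set SolidTorus) : Prop :=
  ∃ H : unitInterval → (SolidTorus ≃ₜ SolidTorus),
    Continuous (fun p : unitInterval × SolidTorus => H p.1 p.2) ∧
    (∀ x : SolidTorus, H 0 x = x) ∧
    (∀ (t : unitInterval) (x : SolidTorus), ‖(x.2 : ℂ)‖ = 1 → H t x = x) ∧
    H 1 '' K = L

namespace GeneralizedMazur

/-- The point of the universal cover `ℝ × D² ⊆ ℝ × ℂ` with angular coordinate `θ` (one full turn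
is `1`), at height level `l` and with third coordinate `z`. The levels `0, 1, …, m + n + 1` are
equally spaced heights from `-1/2` to `1/2`; the height is the real and `z` the imaginary part of
the disc coordinate. In pictures the knot is projected along `z` to the annulus, larger `z` being
nearer to the viewer. -/
noncomputable def point (m n : ℕ) (θ l z : ℝ) : ℝ × ℂ :=
  (θ, ⟨(2 * l - (m + n + 1)) / (2 * (m + n + 1)), z⟩)

/-- The vertices of a lift to the universal cover of the closed polygon `Q_{m,n}`. The first four
edges form a planar arc (`z = 0`): from level `0` at the angle `θ = 0` it winds `m` times around,
rising one level per turn, turns around just after having passed the angle `θ = 0` again, and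
winds `n` times backwards, rising one level per turn, up to level `m + n + 1`. The other five edges
lie over the angle `θ = 0` and join the top endpoint to the bottom endpoint: they run under
(`z = -1/4`) the `n` backward strands, at the levels `m + n, …, m + 1`, come up between the two
legs of the turn (the clasp), and run over (`z = 1/4`) the `m` forward strands, at the levels
`m, …, 1`. -/
noncomputable def vertex (m n : ℕ) : Fin 10 → ℝ × ℂ :=
  ![point m n 0 0 0,
    point m n m m 0,
    point m n (m + 1 / 4) (m + 1 / 2) 0,
    point m n m (m + 1) 0,
    point m n (m - n) (m + n + 1) 0,
    point m n (m - n) (m + n + 1) (-1 / 4),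
    point m n (m - n) (m + 1 / 2) (-1 / 4),
    point m n (m - n) (m + 1 / 2) (1 / 4),
    point m n (m - n) 0 (1 / 4),
    point m n (m - n) 0 0]

/-- The generalized Mazur pattern `Q_{m,n}` in the solid torus (`m, n ≥ 1`), as a set: the image
under the covering map `(θ, v) ↦ (exp (2 π i θ), v)` of the polygonal path with the vertices
`vertex m n`. (All these vertices lie in the interior of `ℝ × D²`.) -/
def pattern (m n : ℕ) : Set SolidTorus :=
  {p | ∃ i : Fin 9, ∃ x ∈ segment ℝ (vertex m n i.castSucc) (vertex m n i.succ),
    Circle.exp (2 * Real.pi * x.1) = p.1 ∧ x.2 = (p.2 : ℂ)}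

end GeneralizedMazur

/-! Rotating each meridian disc by `π` about its centre sends level `l` to `m + n + 1 - l` and depth
`z` to `-z`. The `m` forward turns become the last `m` turns of a spiral traversed backwards, and
under- and overcrossings of the joining arc are exchanged, so the image of `Q_{m,n}` is `Q_{n,m}`
with reversed direction (`exists_edge_eq_screw`). The knot lies within radius `3 / 5`, so the
rotation can be damped to the identity near the boundary and joined to it through the twists by
smaller angles (`isotopic_twist_image`). -/

namespace SolidTorus

/-- The angle, as a multiple of the total angle, by which `twist` turns the circle of radius `r`:
constant on the disc of radius `3 / 5` and zero at the boundary. -/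
noncomputable def taper (r : ℝ) : ℝ := min 1 ((1 - r) * (5 / 2))

lemma continuous_taper : Continuous taper := by
  unfold taper; fun_prop

lemma taper_one : taper 1 = 0 := by simp [taper]

lemma taper_of_le {r : ℝ} (hr : r ≤ 3 / 5) : taper r = 1 := by
  unfold taper; exact min_eq_left (by linarith)

/-- Turn every meridian disc about its centre by the angle `s`, tapering off to the identity
on the boundary. -/
noncomputable def twistFun (s : ℝ) (p : SolidTorus) : SolidTorus :=
  (p.1, ⟨(Circle.exp (s * taper ‖(p.2 : ℂ)‖) : ℂ) * p.2, by
    have h := p.2.2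
    rw [mem_closedBall_zero_iff] at h ⊢
    rwa [norm_mul, Circle.norm_coe, one_mul]⟩)

lemma twistFun_snd (s : ℝ) (p : SolidTorus) :
    ((twistFun s p).2 : ℂ) = (Circle.exp (s * taper ‖(p.2 : ℂ)‖) : ℂ) * p.2 := rfl

/-- Twisting preserves the radius, so both factors use the same taper value and the angles add. -/
lemma twistFun_twistFun (s t : ℝ) (p : SolidTorus) :
    twistFun s (twistFun t p) = twistFun (s + t) p := by
  refine Prod.ext rfl (Subtype.ext ?_)
  simp only [twistFun_snd, norm_mul, Circle.norm_coe, one_mul, add_mul, Circle.exp_add,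
    Circle.coe_mul, mul_assoc]

lemma twistFun_zero (p : SolidTorus) : twistFun 0 p = p :=
  Prod.ext rfl (Subtype.ext (by simp [twistFun_snd]))

lemma twistFun_of_norm_eq_one (s : ℝ) {p : SolidTorus} (hp : ‖(p.2 : ℂ)‖ = 1) :
    twistFun s p = p :=
  Prod.ext rfl (Subtype.ext (by simp [twistFun_snd, hp, taper_one]))

lemma continuous_twistFun : Continuous (fun q : ℝ × SolidTorus => twistFun q.1 q.2) := by
  have := continuous_taper
  unfold twistFun
  fun_prop

/-- `twistFun s` as a homeomorphism. -/
noncomputable def twist (s : ℝ) : SolidTorus ≃ₜ SolidTorus where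
  toFun := twistFun s
  invFun := twistFun (-s)
  left_inv p := by rw [twistFun_twistFun, neg_add_cancel, twistFun_zero]
  right_inv p := by rw [twistFun_twistFun, add_neg_cancel, twistFun_zero]
  continuous_toFun := continuous_twistFun.comp (.prodMk_right s)
  continuous_invFun := continuous_twistFun.comp (.prodMk_right (-s))

/-- The half twist is the rotation by `π` away from the boundary. -/
lemma twist_pi_snd {p : SolidTorus} (hp : ‖(p.2 : ℂ)‖ ≤ 3 / 5) :
    ((twist Real.pi p).2 : ℂ) = -p.2 := by
  change ((twistFun Real.pi p).2 : ℂ) = _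
  simp [twistFun_snd, taper_of_le hp]

lemma twist_pi_twist_pi {p : SolidTorus} (hp : ‖(p.2 : ℂ)‖ ≤ 3 / 5) :
    twist Real.pi (twist Real.pi p) = p := by
  refine Prod.ext rfl (Subtype.ext ?_)
  rw [twist_pi_snd (by rwa [twist_pi_snd hp, norm_neg]), twist_pi_snd hp, neg_neg]

/-- Every set is isotopic to its image under a twist. -/
lemma isotopic_twist_image (s : ℝ) (K : Set SolidTorus) : Isotopic K (twist s '' K) := by
  refine ⟨fun t => twist (t * s), ?_, ?_, fun t x hx => twistFun_of_norm_eq_one _ hx, ?_⟩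
  · exact continuous_twistFun.comp
      (f := fun p : unitInterval × SolidTorus => ((p.1 : ℝ) * s, p.2)) (by fun_prop)
  · intro x
    change twistFun _ x = x
    simp [twistFun_zero]
  · simp

end SolidTorus

namespace GeneralizedMazur

open SolidTorus

/-- Rotation of `ℝ × ℂ` about the axis `ℝ` by `π`, followed by a translation along the axis. -/
def screw (k : ℝ) (x : ℝ × ℂ) : ℝ × ℂ := (x.1 + k, -x.2)

lemma screw_mem_segment (k : ℝ) {a b x : ℝ × ℂ} (hx : x ∈ segment ℝ a b) :
    screw k x ∈ segment ℝ (screw k b) (screw k a) := by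
  rw [segment_symm]
  obtain ⟨s, t, hs, ht, hst, rfl⟩ := hx
  refine ⟨s, t, hs, ht, hst, Prod.ext ?_ ?_⟩
  · simp only [screw, Prod.fst_add, Prod.smul_fst, smul_eq_mul]
    linear_combination k * hst
  · simp only [screw, Prod.snd_add, Prod.smul_snd, smul_neg, neg_add]

lemma screw_point (m n : ℕ) (k θ l z : ℝ) :
    screw k (point m n θ l z) = point n m (θ + k) (m + n + 1 - l) (-z) := by
  refine Prod.ext rfl (Complex.ext ?_ rfl)
  have h : (m + n + 1 : ℝ) ≠ 0 := by positivity
  have h' : (n + m + 1 : ℝ) ≠ 0 := by positivity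
  simp only [screw, point, Complex.neg_re]
  field_simp
  ring

/-- The screw motions carry the edges of the polygon for `(m, n)` to the edges of the polygon for
`(n, m)`, up to deck transformations, reversing their direction. -/
lemma exists_edge_eq_screw (m n : ℕ) (i : Fin 9) : ∃ (j : Fin 9) (k : ℤ),
    vertex n m j.castSucc = screw k (vertex m n i.succ) ∧
    vertex n m j.succ = screw k (vertex m n i.castSucc) := by
  have key (θ l z θ' l' z' : ℝ) (k : ℝ) (h₁ : θ = θ' + k) (h₂ : l = m + n + 1 - l')
      (h₃ : z = -z') : point n m θ l z = screw k (point m n θ' l' z') := by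
    rw [screw_point, h₁, h₂, h₃]
  set d : ℤ := n - m with hd
  -- The spiral and the joining arc are each reversed. The lifted path does not close up: the spiral
  -- runs from angle `0` to `m - n`, and reversal onto `0` to `n - m` needs the shift `d`; the
  -- joining arc moves from `m - n` to `n - m`, a shift by `2 * d`.
  refine ⟨![3, 2, 1, 0, 8, 7, 6, 5, 4] i,
    ![d, d, d, d, 2 * d, 2 * d, 2 * d, 2 * d, 2 * d] i, ?_⟩
  fin_cases i <;> constructor <;> apply key <;> push_cast [hd] <;> ring

lemma norm_point_snd_le (m n : ℕ) (θ : ℝ) {l z : ℝ} (h₀ : 0 ≤ l) (h₁ : l ≤ m + n + 1)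
    (hz : |z| ≤ 1 / 4) : ‖(point m n θ l z).2‖ ≤ 3 / 5 := by
  have hN : (0 : ℝ) < 2 * (m + n + 1) := by positivity
  set x : ℝ := (2 * l - (m + n + 1)) / (2 * (m + n + 1)) with hx
  have hx' : |x| ≤ 1 / 2 := by
    rw [abs_le, hx, le_div_iff₀ hN, div_le_iff₀ hN]
    constructor <;> linarith
  rw [Complex.norm_eq_sqrt_sq_add_sq]
  refine Real.sqrt_le_iff.2 ⟨by norm_num, ?_⟩
  change x ^ 2 + z ^ 2 ≤ _
  have h₂ := sq_le_sq' (abs_le.1 hx').1 (abs_le.1 hx').2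
  have h₃ := sq_le_sq' (abs_le.1 hz).1 (abs_le.1 hz).2
  -- `1/4 + 1/16 = 5/16 < 9/25`.
  linarith

lemma norm_vertex_snd_le (m n : ℕ) (i : Fin 10) : ‖(vertex m n i).2‖ ≤ 3 / 5 := by
  have hm : (0 : ℝ) ≤ m := m.cast_nonneg
  have hn : (0 : ℝ) ≤ n := n.cast_nonneg
  fin_cases i <;> refine norm_point_snd_le m n _ ?_ ?_ ?_ <;> linarith

lemma norm_snd_le_of_mem_pattern {m n : ℕ} {p : SolidTorus} (hp : p ∈ pattern m n) :
    ‖(p.2 : ℂ)‖ ≤ 3 / 5 := by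
  obtain ⟨i, x, hx, -, h⟩ := hp
  rw [← h]
  have hv (i : Fin 10) : (vertex m n i).2 ∈ Metric.closedBall (0 : ℂ) (3 / 5) :=
    mem_closedBall_zero_iff.2 (norm_vertex_snd_le m n i)
  obtain ⟨s, t, hs, ht, hst, rfl⟩ := hx
  exact mem_closedBall_zero_iff.1 (convex_closedBall (0 : ℂ) (3 / 5) (hv _) (hv _) hs ht hst)

lemma twist_pi_mem_pattern {m n : ℕ} {p : SolidTorus} (hp : p ∈ pattern m n) :
    twist Real.pi p ∈ pattern n m := by
  have hle := norm_snd_le_of_mem_pattern hp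
  obtain ⟨i, x, hx, h₁, h₂⟩ := hp
  obtain ⟨j, k, hj, hj'⟩ := exists_edge_eq_screw m n i
  refine ⟨j, screw k x, ?_, ?_, ?_⟩
  · rw [hj, hj']
    exact screw_mem_segment k hx
  · change _ = p.1
    rw [← h₁]
    simp only [screw, mul_add, Circle.exp_add]
    rw [mul_comm (2 * Real.pi) (k : ℝ), Circle.exp_int_mul_two_pi, mul_one]
  · rw [twist_pi_snd hle, ← h₂]
    rfl

lemma twist_pi_image_pattern (m n : ℕ) : twist Real.pi '' pattern m n = pattern n m := by
  refine Set.Subset.antisymm (Set.image_subset_iff.2 fun p hp => twist_pi_mem_pattern hp) ?_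
  intro q hq
  -- The inclusion with `m` and `n` swapped suffices, as the half twist is an involution on the
  -- patterns.
  exact ⟨twist Real.pi q, twist_pi_mem_pattern hq,
    twist_pi_twist_pi (norm_snd_le_of_mem_pattern hq)⟩

end GeneralizedMazur

theorem proposition1p4 (m n : ℕ) (hm : 1 ≤ m) (hn : 1 ≤ n) :
    SolidTorus.Isotopic (GeneralizedMazur.pattern m n) (GeneralizedMazur.pattern n m) := by
  rw [← GeneralizedMazur.twist_pi_image_pattern m n]
  exact SolidTorus.isotopic_twist_image _ _
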